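/- Let $n\ge 2$ be an integer, $\alpha>-1$, $\mu\ge 0$, and set $K(x)=|x|^{n\alpha}e^{-\mu|x|^2}$ for $x\in\mathbb{R}^n\setminus\{0\}$. Let $|S^n|$ be the surface area of the unit sphere in $\mathbb{R}^{n+1}$, $\Lambda_1:=(n-1)!\,|S^n|$ and $\gamma_n:=\frac{(n-1)!}{2}|S^n|$. Let $\eta:\mathbb{R}^n\to\mathbb{R}$ be measurable with $$\Lambda:=\int_{\mathbb{R}^n}K(x)e^{n\eta(x)}\,dx<+\infty,$$ and suppose that for some constant $c\in\mathbb{R}$ $$\eta(x)=\frac{1}{\gamma_n}\int_{\mathbb{R}^n}\log\left(\frac{1+|y|}{|x-y|}\right)K(y)e^{n\eta(y)}\,dy+c\qquad\text{for almost every }x\in\mathbb{R}^n,$$ the integral being absolutely convergent for almost every $x$. Then $\Lambda\le\Lambda_1(1+\alpha)$, and equality holds if and only if $\mu=0$. -/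

import Mathlib

open MeasureTheory

noncomputable section

namespace LogIntegralEq

/-- The Euclidean space `ℝⁿ`. -/
abbrev Eucl (n : ℕ) : Type := EuclideanSpace ℝ (Fin n)

/-- `|Sⁿ|`: the total surface measure of the unit sphere of `ℝⁿ⁺¹`. -/
def sphereArea (n : ℕ) : ℝ :=
  ((volume : Measure (Eucl (n + 1))).toSphere).real Set.univ

/-- `γₙ = ((n - 1)! / 2) |Sⁿ|`. -/
def gammaConst (n : ℕ) : ℝ :=
  ((Nat.factorial (n - 1) : ℝ) / 2) * sphereArea n

/-- `Λ₁ = (n - 1)! |Sⁿ|`. -/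
def Lambda1 (n : ℕ) : ℝ :=
  (Nat.factorial (n - 1) : ℝ) * sphereArea n

/-- The weight `K(x) = |x|^{nα} e^{-μ|x|²}` (its value at the origin is irrelevant). -/
def weight (n : ℕ) (α μ : ℝ) (x : Eucl n) : ℝ :=
  ‖x‖ ^ ((n : ℝ) * α) * Real.exp (-μ * ‖x‖ ^ 2)

/-- The density `K(x) e^{nη(x)}`. -/
def density (n : ℕ) (K η : Eucl n → ℝ) (x : Eucl n) : ℝ :=
  K x * Real.exp ((n : ℝ) * η x)

/-- `η` solves
`η(x) = (1/γₙ) ∫ log((1+|y|)/|x-y|) K(y) e^{nη(y)} dy + c`: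
for almost every `x` the integral converges absolutely and the equation holds. -/
def SolvesIntegralEq (n : ℕ) (K : Eucl n → ℝ) (c : ℝ) (η : Eucl n → ℝ) : Prop :=
  ∀ᵐ x : Eucl n,
    Integrable (fun y : Eucl n => Real.log ((1 + ‖y‖) / ‖x - y‖) * density n K η y) ∧
    η x = (1 / gammaConst n) *
      (∫ y : Eucl n, Real.log ((1 + ‖y‖) / ‖x - y‖) * density n K η y) + c

end LogIntegralEq

end

/-!
The proof rests on a variational reading of the Pohozaev identity that needs no regularity of `η`.
Write `ρ = K e^{nη}`, `ν = ρ dx` and `β = n / γₙ`. For `λ > 0` the function `λⁿρ(λx)` has the same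
integral as `ρ`, so Gibbs' inequality gives `∫ ρ log (λⁿρ(λx) / ρ(x)) dx ≤ 0`, with equality at
`λ = 1`. By the integral equation the left side equals

  `n(1 + α) Λ log λ - (λ² - 1) μ ∫ |x|² dν - β ∬ log (|λx - y| / |x - y|) dν dν`

(`dilation_inequality`). Its maximum is at `λ = 1`, hence its derivative vanishes there. The kernel
has derivative `x·(x - y) / |x - y|²` at `λ = 1`, whose double integral is `Λ² / 2` by symmetry
(`integral_virialKernel`). This yields `virial_identity`:
`n(1 + α)Λ = 2μ ∫ |x|² dν + βΛ² / 2`, that is,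
`nΛ (Λ₁(1 + α) - Λ) = 4 γₙ μ ∫ |x|² dν`, and the right side is positive unless `μ = 0`.

Two points need care. Differentiability of the double integral is obtained by dominated convergence:
the logarithm is bounded above by `|λ - 1| |x| / |x - y|`, and since only an inequality is needed it
may be cut off from below at the negative of that bound (`cutDilLog`). The bound itself is integrable
because `|x| ∫ ρ(y) / |x - y| dy` is bounded in `x` (`exists_lintegral_div_norm_sub_le`). This is a
dilation invariant form of the exponential integrability of logarithmic potentials of small mass:
`ν` is uniformly small on the balls `B(x, 4s|x|)` (`exists_mass_ball_le`), on which `ρ` is compared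
with its average (`exists_density_le`) and the potential of the mass in the ball is handled by
Jensen's inequality.
-/

open MeasureTheory Metric Set Filter Topology

noncomputable section

namespace LogIntegralEq

/-! ### The kernel `(R / |y - z|)^{3/2}` on balls and Jensen's inequality -/

/-- `t ^ (3/2)`, written so that no real powers are needed. -/
def threeHalves (t : ℝ) : ℝ := t * √t

lemma measurable_threeHalves : Measurable threeHalves := by
  unfold threeHalves; fun_prop

/-- Separates the two singularities of a product kernel. -/
lemma mul_sqrt_le_threeHalves_add {a b : ℝ} (ha : 0 ≤ a) (hb : 0 ≤ b) :
    a * √b ≤ threeHalves a + threeHalves b := by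
  unfold threeHalves
  have h1 := Real.sqrt_nonneg a
  have h2 := Real.sqrt_nonneg b
  rcases le_total a b with h | h
  · nlinarith [mul_nonneg ha h1, mul_le_mul_of_nonneg_right h h2]
  · nlinarith [mul_nonneg hb h2, mul_le_mul_of_nonneg_left (Real.sqrt_le_sqrt h) ha]

/-- The singularity is integrable since `3 / 2 < 2 ≤ n`. -/
lemma integrableOn_threeHalves_inv_norm {n : ℕ} (hn : 2 ≤ n) :
    IntegrableOn (fun w : Eucl n => threeHalves (1 / ‖w‖)) (ball 0 1) := by
  have : Nonempty (Fin n) := ⟨⟨0, by omega⟩⟩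
  have key := integrableOn_fun_norm_addHaar (volume : Measure (Eucl n)) (r := 1)
    (f := fun t : ℝ => threeHalves (1 / t))
  refine key.2 ?_
  have h : IntegrableOn (fun t : ℝ => t ^ (-(1/2) : ℝ)) (Ioo 0 1) :=
    (intervalIntegral.integrableOn_Ioo_rpow_iff one_pos).2 (by norm_num)
  refine Integrable.mono' h ?_ ?_
  · refine Measurable.aestronglyMeasurable ?_
    exact (measurable_id.pow_const _).smul (measurable_threeHalves.comp (by fun_prop))
  · filter_upwards [ae_restrict_mem measurableSet_Ioo] with t ht
    have ht0 : 0 < t := ht.1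
    have hs := Real.sqrt_pos.2 ht0
    have hpow : t ^ (n - 1) ≤ t := by
      simpa using pow_le_pow_of_le_one ht0.le ht.2.le (show 1 ≤ n - 1 by omega)
    have e : t ^ (-(1/2) : ℝ) = 1 / √t := by
      rw [Real.rpow_neg ht0.le, ← Real.sqrt_eq_rpow, one_div]
    have hf : 0 ≤ threeHalves (1 / t) := by unfold threeHalves; positivity
    simp only [finrank_euclideanSpace, Fintype.card_fin, smul_eq_mul]
    rw [Real.norm_of_nonneg (by positivity), e]
    calc t ^ (n - 1) * threeHalves (1 / t) ≤ t * threeHalves (1 / t) := by gcongr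
      _ = 1 / √t := by
        unfold threeHalves
        rw [Real.sqrt_div zero_le_one, Real.sqrt_one]
        field_simp

lemma exists_setLIntegral_threeHalves_le {n : ℕ} (hn : 2 ≤ n) :
    ∃ C : ENNReal, C ≠ ⊤ ∧ ∀ (z : Eucl n) (R : ℝ), 0 < R →
      ∫⁻ y in ball z R, ENNReal.ofReal (threeHalves (R / ‖y - z‖)) ≤
        C * ENNReal.ofReal (R ^ n) := by
  refine ⟨∫⁻ w in ball (0 : Eucl n) 1, ENNReal.ofReal (threeHalves (1 / ‖w‖)), ?_, ?_⟩
  · exact (integrableOn_threeHalves_inv_norm hn).lintegral_lt_top.ne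
  · intro z R hR
    have hm : Measurable (fun y : Eucl n => ENNReal.ofReal (threeHalves (R / ‖y‖))) :=
      (measurable_threeHalves.comp (by fun_prop)).ennreal_ofReal
    rw [← lintegral_indicator measurableSet_ball, ← lintegral_indicator measurableSet_ball]
    have e1 : ∀ y : Eucl n, (ball z R).indicator
        (fun y => ENNReal.ofReal (threeHalves (R / ‖y - z‖))) y =
        (ball (0 : Eucl n) R).indicator
          (fun y => ENNReal.ofReal (threeHalves (R / ‖y‖))) (y - z) := by
      intro y
      simp [indicator, mem_ball, dist_eq_norm]
    simp_rw [e1]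
    rw [lintegral_sub_right_eq_self]
    -- substitute `y = R w`
    set g := (ball (0 : Eucl n) R).indicator (fun y => ENNReal.ofReal (threeHalves (R / ‖y‖)))
    have hg : Measurable g := hm.indicator measurableSet_ball
    have e2 : ∀ w : Eucl n, (ball (0 : Eucl n) 1).indicator
        (fun w => ENNReal.ofReal (threeHalves (1 / ‖w‖))) w = g (R • w) := by
      intro w
      have : R * ‖w‖ < R ↔ ‖w‖ < 1 := by
        constructor <;> intro h <;> nlinarith
      have h3 : R / (R * ‖w‖) = 1 / ‖w‖ := by field_simp
      simp [g, indicator, norm_smul, abs_of_pos hR, this, h3]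
    have h4 := lintegral_map (μ := (volume : Measure (Eucl n))) hg
      (measurable_const_smul R : Measurable (fun w : Eucl n => R • w))
    rw [Measure.map_addHaar_smul _ hR.ne', lintegral_smul_measure] at h4
    simp only [finrank_euclideanSpace, Fintype.card_fin] at h4
    simp_rw [e2]
    rw [← h4, abs_of_pos (by positivity), smul_eq_mul, mul_comm, ← mul_assoc,
      ← ENNReal.ofReal_mul (by positivity), mul_inv_cancel₀ (by positivity)]
    simp

/-- Jensen's inequality for the exponential and a measure of mass at most `1 / (2β)`. -/
lemma ofReal_exp_mul_integral_le {X : Type*} [MeasurableSpace X] {κ : Measure X}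
    [IsFiniteMeasure κ] (hκ : κ ≠ 0) {β : ℝ} (hβ : β * κ.real univ ≤ 1 / 2)
    {f : X → ℝ} (hf : Integrable f κ) (hf0 : 0 ≤ᵐ[κ] f) :
    ENNReal.ofReal (Real.exp (β * ∫ x, f x ∂κ)) ≤
      (κ univ)⁻¹ * ∫⁻ x, ENNReal.ofReal (Real.exp (f x / 2)) ∂κ := by
  have : NeZero κ := ⟨hκ⟩
  have hm : 0 < κ.real univ := measureReal_univ_pos
  by_cases htop : ∫⁻ x, ENNReal.ofReal (Real.exp (f x / 2)) ∂κ = ⊤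
  · rw [htop, ENNReal.mul_top (by simp)]; exact le_top
  have hint : Integrable (fun x => Real.exp (f x / 2)) κ := by
    refine (lintegral_ofReal_ne_top_iff_integrable ?_ ?_).1 htop
    · exact Real.continuous_exp.comp_aestronglyMeasurable
        (hf.div_const 2).aestronglyMeasurable
    · exact Eventually.of_forall fun x => (Real.exp_pos _).le
  have jen := convexOn_exp.map_average_le (μ := κ) (f := fun x => f x / 2)
    Real.continuous_exp.continuousOn isClosed_univ (by simp) (hf.div_const 2) hint
  rw [average_eq, average_eq, integral_div, smul_eq_mul, smul_eq_mul] at jen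
  have h1 : β * ∫ x, f x ∂κ ≤ (κ.real univ)⁻¹ * ((∫ x, f x ∂κ) / 2) := by
    have h0 : 0 ≤ ∫ x, f x ∂κ := integral_nonneg_of_ae hf0
    have : β ≤ (κ.real univ)⁻¹ * (1 / 2) := by
      rw [inv_mul_eq_div, le_div_iff₀ hm]; exact hβ
    nlinarith
  rw [← ofReal_integral_eq_lintegral_ofReal hint
    (Eventually.of_forall fun x => (Real.exp_pos _).le)]
  have h2 : (κ univ)⁻¹ = ENNReal.ofReal (κ.real univ)⁻¹ := by
    rw [ENNReal.ofReal_inv_of_pos hm, ofReal_measureReal]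
  rw [h2, ← ENNReal.ofReal_mul (by positivity)]
  exact ENNReal.ofReal_le_ofReal ((Real.exp_le_exp.2 h1).trans jen)

/-! ### Solutions of the integral equation as measures -/

/-- The measure `ρ dx`; negative values of `ρ` are replaced by zero. -/
def mass {n : ℕ} (ρ : Eucl n → ℝ) : Measure (Eucl n) :=
  volume.withDensity fun x => ENNReal.ofReal (ρ x)

/-- The kernel of the integral equation; it has the junk value `0` on the diagonal. -/
def logKernel {n : ℕ} (x y : Eucl n) : ℝ := Real.log ((1 + ‖y‖) / ‖x - y‖)

/-- At the point `x` the density `ρ` equals `K e^{βU + c}`, with `U` the (absolutely convergent)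
logarithmic potential of the measure `ν`. -/
def SolvesAt {n : ℕ} (ν : Measure (Eucl n)) (K : Eucl n → ℝ) (β c : ℝ) (ρ : Eucl n → ℝ)
    (x : Eucl n) : Prop :=
  Integrable (logKernel x) ν ∧ ρ x = K x * Real.exp (β * ∫ y, logKernel x y ∂ν + c)

variable {n : ℕ}

lemma mass_absolutelyContinuous (ρ : Eucl n → ℝ) : mass ρ ≪ volume :=
  withDensity_absolutelyContinuous _ _

lemma isFiniteMeasure_mass {ρ : Eucl n → ℝ} (hρ : Integrable ρ) : IsFiniteMeasure (mass ρ) :=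
  isFiniteMeasure_withDensity_ofReal hρ.2

lemma nullSingletonClass_mass (hn : 2 ≤ n) (ρ : Eucl n → ℝ) : NullSingletonClass (mass ρ) := by
  have : Nonempty (Fin n) := ⟨⟨0, by omega⟩⟩
  exact ⟨fun x => mass_absolutelyContinuous ρ (measure_singleton x)⟩

lemma integral_mass {ρ : Eucl n → ℝ} (hρ : Integrable ρ) (h0 : ∀ x, 0 ≤ ρ x) (f : Eucl n → ℝ) :
    ∫ x, f x ∂(mass ρ) = ∫ x, ρ x * f x := by
  unfold mass
  rw [integral_withDensity_eq_integral_toReal_smul₀ hρ.aemeasurable.ennreal_ofReal (by simp)]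
  simp [ENNReal.toReal_ofReal (h0 _)]

lemma integrable_mass_iff {ρ : Eucl n → ℝ} (hρ : Integrable ρ) (h0 : ∀ x, 0 ≤ ρ x)
    {f : Eucl n → ℝ} : Integrable f (mass ρ) ↔ Integrable fun x => ρ x * f x := by
  unfold mass
  rw [integrable_withDensity_iff_integrable_smul₀' hρ.aemeasurable.ennreal_ofReal (by simp)]
  simp [ENNReal.toReal_ofReal (h0 _)]

lemma mass_real_univ {ρ : Eucl n → ℝ} (hρ : Integrable ρ) (h0 : ∀ x, 0 ≤ ρ x) :
    (mass ρ).real univ = ∫ x, ρ x := by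
  have := integral_mass hρ h0 (fun _ => 1)
  simpa using this

/-- The quotient of the values of a solution at two points involves only the scale invariant
kernel `log (|x' - y| / |x - y|)`. -/
lemma SolvesAt.ratio {ν : Measure (Eucl n)} [NullSingletonClass ν] {K ρ : Eucl n → ℝ} {β c : ℝ}
    {x x' : Eucl n} (hx : SolvesAt ν K β c ρ x) (hx' : SolvesAt ν K β c ρ x') :
    Integrable (fun y => Real.log (‖x' - y‖ / ‖x - y‖)) ν ∧
      ρ x * K x' = ρ x' * K x * Real.exp (β * ∫ y, Real.log (‖x' - y‖ / ‖x - y‖) ∂ν) := by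
  have hae : (fun y => logKernel x y - logKernel x' y) =ᵐ[ν]
      fun y => Real.log (‖x' - y‖ / ‖x - y‖) := by
    filter_upwards [compl_mem_ae_iff.2 (measure_singleton (μ := ν) x),
      compl_mem_ae_iff.2 (measure_singleton (μ := ν) x')] with y h1 h2
    have h1' : ‖x - y‖ ≠ 0 := by
      rw [norm_ne_zero_iff, sub_ne_zero]; exact fun h => h1 (by simp [h])
    have h2' : ‖x' - y‖ ≠ 0 := by
      rw [norm_ne_zero_iff, sub_ne_zero]; exact fun h => h2 (by simp [h])
    have h3 : (1 + ‖y‖) ≠ 0 := by positivity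
    unfold logKernel
    rw [Real.log_div h3 h1', Real.log_div h3 h2', Real.log_div h2' h1']
    ring
  refine ⟨(hx.1.sub hx'.1).congr hae, ?_⟩
  rw [← integral_congr_ae hae, integral_sub hx.1 hx'.1, hx.2, hx'.2]
  have : β * ∫ y, logKernel x y ∂ν + c = (β * ∫ y, logKernel x' y ∂ν + c) +
    β * (∫ y, logKernel x y ∂ν - ∫ y, logKernel x' y ∂ν) := by ring
  rw [this, Real.exp_add]
  ring

/-- A finite absolutely continuous measure is uniformly small on balls `B(x, 4s|x|)`: it is
absolutely continuous with respect to the dilation invariant measure `dx / |x|ⁿ`, for which all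
these balls are uniformly small. -/
lemma exists_mass_ball_le (hn : 2 ≤ n) {ρ : Eucl n → ℝ} (hρ : Integrable ρ) {ε : ℝ}
    (hε : 0 < ε) :
    ∃ s : ℝ, 0 < s ∧ s ≤ 1 / 8 ∧
      ∀ x : Eucl n, x ≠ 0 → (mass ρ).real (ball x (4 * s * ‖x‖)) ≤ ε := by
  have : Nonempty (Fin n) := ⟨⟨0, by omega⟩⟩
  -- `τ = dx / |x|ⁿ`, and `ρ dx = f dτ`
  set w : Eucl n → ENNReal := fun x => ENNReal.ofReal (‖x‖ ^ n)⁻¹ with hw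
  have hwm : Measurable w := by rw [hw]; fun_prop
  set τ : Measure (Eucl n) := volume.withDensity w with hτ
  set f : Eucl n → ENNReal := fun x => ENNReal.ofReal (‖x‖ ^ n) * ENNReal.ofReal (ρ x) with hf
  have hfm : AEMeasurable f :=
    (Measurable.aemeasurable (by fun_prop)).mul hρ.aemeasurable.ennreal_ofReal
  have hwf : (w * f) =ᵐ[volume] fun x => ENNReal.ofReal (ρ x) := by
    filter_upwards [compl_mem_ae_iff.2 (measure_singleton (μ := (volume : Measure (Eucl n))) 0)]
      with x hx
    have hx' : 0 < ‖x‖ := norm_pos_iff.2 hx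
    simp only [hw, hf, Pi.mul_apply]
    rw [← mul_assoc, ← ENNReal.ofReal_mul (by positivity), inv_mul_cancel₀ (by positivity)]
    simp
  have htop : ∫⁻ x, f x ∂τ ≠ ⊤ := by
    rw [hτ, lintegral_withDensity_eq_lintegral_mul₀ hwm.aemeasurable hfm, lintegral_congr_ae hwf]
    exact hρ.lintegral_lt_top.ne
  obtain ⟨δ, hδ, H⟩ := exists_pos_setLIntegral_lt_of_measure_lt htop
    (ENNReal.ofReal_pos.2 hε).ne'
  set V := (volume : Measure (Eucl n)) (ball 0 1) with hV
  have hlim : Tendsto (fun s : ℝ => ENNReal.ofReal (8 * s) * V) (𝓝[>] 0) (𝓝 0) := by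
    have h1 : Tendsto (fun s : ℝ => ENNReal.ofReal (8 * s)) (𝓝[>] 0) (𝓝 (ENNReal.ofReal (8 * 0))) :=
      ((ENNReal.continuous_ofReal.comp (by fun_prop)).tendsto 0).mono_left nhdsWithin_le_nhds
    have h2 := ENNReal.Tendsto.mul_const (b := V) h1 (Or.inr measure_ball_lt_top.ne)
    simpa using h2
  obtain ⟨s, ⟨hs1, hs2⟩, hs3⟩ := ((hlim.eventually (gt_mem_nhds hδ)).and
    (Ioo_mem_nhdsGT (show (0 : ℝ) < 1 / 8 by norm_num))).exists.imp
      fun s h => And.intro (And.intro h.1 h.2.1) h.2.2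
  refine ⟨s, hs2, hs3.le, fun x hx => ?_⟩
  have hR : 0 < ‖x‖ := norm_pos_iff.2 hx
  set B := ball x (4 * s * ‖x‖)
  have hτB : τ B < δ := by
    refine lt_of_le_of_lt ?_ hs1
    rw [hτ, withDensity_apply _ measurableSet_ball]
    calc ∫⁻ y in B, w y ≤ ∫⁻ _ in B, ENNReal.ofReal ((‖x‖ / 2) ^ n)⁻¹ := by
          refine setLIntegral_mono (by fun_prop) fun y hy => ?_
          refine ENNReal.ofReal_le_ofReal ?_
          have h1 : ‖x‖ / 2 ≤ ‖y‖ := by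
            have h2 : ‖y - x‖ < 4 * s * ‖x‖ := by simpa [B, dist_eq_norm] using hy
            have h3 : ‖x‖ ≤ ‖y‖ + ‖y - x‖ := by
              have := norm_sub_le y (y - x); simpa using this
            nlinarith
          gcongr
      _ = ENNReal.ofReal ((8 * s) ^ n) * V := by
          rw [setLIntegral_const, Measure.addHaar_ball_of_pos _ _ (by positivity), ← hV,
            finrank_euclideanSpace, Fintype.card_fin, ← mul_assoc,
            ← ENNReal.ofReal_mul (by positivity), ← inv_pow, ← mul_pow]
          congr 3
          field_simp
          norm_num
      _ ≤ ENNReal.ofReal (8 * s) * V := by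
          gcongr
          exact pow_le_of_le_one (by positivity) (by linarith) (by omega)
  have h1 := H B hτB
  rw [hτ, setLIntegral_withDensity_eq_lintegral_mul₀ hwm.aemeasurable hfm measurableSet_ball,
    setLIntegral_congr_fun_ae measurableSet_ball (hwf.mono fun x hx _ => hx)] at h1
  have h2 : mass ρ B ≤ ENNReal.ofReal ε := by
    rw [mass, withDensity_apply _ measurableSet_ball]; exact h1.le
  exact ENNReal.toReal_le_of_le_ofReal hε.le h2

/-! ### A local bound for the density -/

/-- Near a point at distance `R` from the origin, the potential is dominated by the contribution
`log (R / |y - z|)` of nearby masses; all other masses are seen from `y` and `y'` at comparable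
distances. -/
lemma SolvesAt.le_mul_exp {ν : Measure (Eucl n)} [NullSingletonClass ν] [IsFiniteMeasure ν]
    {K ρ : Eucl n → ℝ} {β c : ℝ} (hβ : 0 ≤ β) {x y y' : Eucl n} {s A : ℝ}
    (hs : 0 < s) (hs8 : s ≤ 1 / 8) (hx : x ≠ 0)
    (hy : y ∈ ball x (2 * s * ‖x‖)) (hy' : y' ∈ ball x (2 * s * ‖x‖))
    (hA : 0 ≤ A) (hKy' : 0 < K y') (hρ' : 0 ≤ ρ y') (hK : K y ≤ A * K y')
    (hsol : SolvesAt ν K β c ρ y) (hsol' : SolvesAt ν K β c ρ y') :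
    IntegrableOn (fun z => Real.log (‖x‖ / ‖y - z‖)) (ball x (4 * s * ‖x‖)) ν ∧
    ρ y ≤ A * ρ y' * Real.exp (β * (Real.log 3 * ν.real univ)) *
      Real.exp (β * ∫ z in ball x (4 * s * ‖x‖), Real.log (‖x‖ / ‖y - z‖) ∂ν) := by
  have hR : 0 < ‖x‖ := norm_pos_iff.2 hx
  set R := ‖x‖ with hRdef
  set B := ball x (4 * s * R)
  have hyx : ‖y - x‖ < 2 * s * R := by simpa [dist_eq_norm] using hy
  have hyx' : ‖y' - x‖ < 2 * s * R := by simpa [dist_eq_norm] using hy'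
  have hne : ∀ᵐ z ∂ν, 0 < ‖y - z‖ ∧ 0 < ‖y' - z‖ := by
    filter_upwards [compl_mem_ae_iff.2 (measure_singleton (μ := ν) y),
      compl_mem_ae_iff.2 (measure_singleton (μ := ν) y')] with z h1 h2
    simp only [norm_pos_iff, ne_eq, sub_eq_zero]
    exact ⟨fun h => h1 (by simp [h]), fun h => h2 (by simp [h])⟩
  have hint : IntegrableOn (fun z => Real.log (R / ‖y - z‖)) B ν := by
    have h1 : IntegrableOn (fun z : Eucl n => Real.log ((1 + ‖z‖) / R)) B ν := by
      refine IntegrableOn.of_bound (measure_lt_top _ _)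
        (Measurable.aestronglyMeasurable (by fun_prop)) (|Real.log (1 / R)| +
          |Real.log ((1 + 2 * R) / R)|) ?_
      filter_upwards [ae_restrict_mem measurableSet_ball] with z hz
      have hz1 : ‖z - x‖ < 4 * s * R := by simpa [B, dist_eq_norm] using hz
      have hz2 : ‖z‖ ≤ 2 * R := by
        have : ‖z‖ ≤ ‖z - x‖ + ‖x‖ := by simpa using norm_add_le (z - x) x
        nlinarith
      have l1 : Real.log (1 / R) ≤ Real.log ((1 + ‖z‖) / R) :=
        Real.log_le_log (by positivity) (by gcongr; linarith [norm_nonneg z])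
      have l2 : Real.log ((1 + ‖z‖) / R) ≤ Real.log ((1 + 2 * R) / R) :=
        Real.log_le_log (by positivity) (by gcongr)
      rw [Real.norm_eq_abs, abs_le]
      constructor
      · linarith [neg_abs_le (Real.log (1 / R)), abs_nonneg (Real.log ((1 + 2 * R) / R))]
      · linarith [le_abs_self (Real.log ((1 + 2 * R) / R)), abs_nonneg (Real.log (1 / R))]
    refine (hsol.1.integrableOn.sub h1).congr ?_
    filter_upwards [ae_restrict_of_ae hne] with z hz
    have h3 : (1 + ‖z‖) ≠ 0 := by positivity
    simp only [Pi.sub_apply, logKernel]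
    rw [Real.log_div h3 hz.1.ne', Real.log_div h3 hR.ne', Real.log_div hR.ne' hz.1.ne']
    ring
  refine ⟨hint, ?_⟩
  obtain ⟨hri, hr⟩ := hsol.ratio hsol'
  have hpt : ∀ᵐ z ∂ν, Real.log (‖y' - z‖ / ‖y - z‖) ≤
      Real.log 3 + B.indicator (fun z => Real.log (R / ‖y - z‖)) z := by
    filter_upwards [hne] with z hz
    by_cases hzB : z ∈ B
    · rw [indicator_of_mem hzB]
      have hz1 : ‖z - x‖ < 4 * s * R := by simpa [B, dist_eq_norm] using hzB
      have hz2 : ‖y' - z‖ ≤ R := by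
        have : ‖y' - z‖ ≤ ‖y' - x‖ + ‖z - x‖ := by
          simpa using norm_sub_le (y' - x) (z - x)
        nlinarith
      have l1 : Real.log (‖y' - z‖ / ‖y - z‖) ≤ Real.log (R / ‖y - z‖) :=
        Real.log_le_log (div_pos hz.2 hz.1) (by gcongr)
      linarith [Real.log_nonneg (show (1 : ℝ) ≤ 3 by norm_num)]
    · rw [indicator_of_notMem hzB, add_zero]
      have hz1 : 4 * s * R ≤ ‖z - x‖ := by simpa [B, dist_eq_norm] using hzB
      refine Real.log_le_log (div_pos hz.2 hz.1) ?_
      rw [div_le_iff₀ hz.1]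
      have t1 : ‖z - x‖ ≤ ‖y - x‖ + ‖y - z‖ := by
        have := norm_sub_le (y - x) (y - z); simpa using this
      have t2 : ‖y' - z‖ ≤ ‖y - z‖ + ‖y' - x‖ + ‖y - x‖ := by
        have e : y' - z = (y - z) + (y' - x) - (y - x) := by abel
        rw [e]
        exact (norm_sub_le _ _).trans (by gcongr; exact norm_add_le _ _)
      linarith
  have hI : ∫ z, Real.log (‖y' - z‖ / ‖y - z‖) ∂ν ≤
      Real.log 3 * ν.real univ + ∫ z in B, Real.log (R / ‖y - z‖) ∂ν := by
    have hi2 : Integrable (B.indicator (fun z => Real.log (R / ‖y - z‖))) ν :=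
      (integrable_indicator_iff measurableSet_ball).2 hint
    refine (integral_mono_ae hri ((integrable_const _).add hi2) hpt).trans_eq ?_
    rw [integral_add' (integrable_const _) hi2, integral_indicator measurableSet_ball,
      integral_const, smul_eq_mul, mul_comm (ν.real univ)]
  have hexp : Real.exp (β * ∫ z, Real.log (‖y' - z‖ / ‖y - z‖) ∂ν) ≤
      Real.exp (β * (Real.log 3 * ν.real univ)) *
        Real.exp (β * ∫ z in B, Real.log (R / ‖y - z‖) ∂ν) := by
    rw [← Real.exp_add, ← mul_add]
    gcongr
  have : ρ y * K y' ≤ (A * ρ y' * Real.exp (β * (Real.log 3 * ν.real univ)) *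
      Real.exp (β * ∫ z in B, Real.log (R / ‖y - z‖) ∂ν)) * K y' := by
    rw [hr]
    calc _ ≤ ρ y' * (A * K y') * (Real.exp (β * (Real.log 3 * ν.real univ)) *
        Real.exp (β * ∫ z in B, Real.log (R / ‖y - z‖) ∂ν)) := by
          refine mul_le_mul (mul_le_mul_of_nonneg_left hK hρ') hexp (Real.exp_pos _).le ?_
          refine mul_nonneg hρ' ?_
          exact mul_nonneg hA hKy'.le
      _ = _ := by ring
  exact le_of_mul_le_mul_right this hKy'

lemma rpow_le_four_rpow_mul {a b : ℝ} (ha : 0 < a) (hb : 0 < b) (hab : a ≤ 4 * b)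
    (hba : b ≤ 4 * a) (p : ℝ) : a ^ p ≤ 4 ^ |p| * b ^ p := by
  have h4 : (4 : ℝ) ^ |p| = Real.exp (Real.log 4 * |p|) := Real.rpow_def_of_pos (by norm_num) _
  rw [h4, Real.rpow_def_of_pos ha, Real.rpow_def_of_pos hb, ← Real.exp_add, Real.exp_le_exp]
  have h1 : Real.log a ≤ Real.log 4 + Real.log b := by
    rw [← Real.log_mul (by norm_num) hb.ne']; exact Real.log_le_log ha hab
  have h2 : Real.log b ≤ Real.log 4 + Real.log a := by
    rw [← Real.log_mul (by norm_num) ha.ne']; exact Real.log_le_log hb hba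
  have h3 : |Real.log a - Real.log b| ≤ Real.log 4 := abs_le.2 ⟨by linarith, by linarith⟩
  have h5 := le_abs_self ((Real.log a - Real.log b) * p)
  rw [abs_mul] at h5
  nlinarith [mul_le_mul_of_nonneg_right h3 (abs_nonneg p)]

lemma weight_pos (α μ : ℝ) {x : Eucl n} (hx : x ≠ 0) : 0 < weight n α μ x := by
  have : 0 < ‖x‖ := norm_pos_iff.2 hx
  unfold weight; positivity

lemma weight_nonneg (α μ : ℝ) (x : Eucl n) : 0 ≤ weight n α μ x := by
  unfold weight; positivity

/-- The weight at `y` is controlled by the weight at comparable points that are not further from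
the origin. -/
lemma weight_le_mul {α μ : ℝ} (hμ : 0 ≤ μ) {y y' : Eucl n} (hy' : y' ≠ 0)
    (h1 : ‖y'‖ ≤ ‖y‖) (h2 : ‖y‖ ≤ 4 * ‖y'‖) :
    weight n α μ y ≤ 4 ^ |(n : ℝ) * α| * weight n α μ y' := by
  have p' : 0 < ‖y'‖ := norm_pos_iff.2 hy'
  have p : 0 < ‖y‖ := p'.trans_le h1
  unfold weight
  rw [← mul_assoc]
  refine mul_le_mul (rpow_le_four_rpow_mul p p' h2 (by linarith) _) ?_ (Real.exp_pos _).le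
    (by positivity)
  rw [Real.exp_le_exp]
  have : ‖y'‖ ^ 2 ≤ ‖y‖ ^ 2 := by gcongr
  nlinarith

/-- The density is bounded by `C |x|⁻ⁿ` times the exponential of a local potential. The constant
comes from comparing with a point, closer to the origin, at which the density does not exceed its
average. -/
lemma exists_density_le (hn : 2 ≤ n) {α μ β c : ℝ} (hμ : 0 ≤ μ) (hβ : 0 ≤ β)
    {ρ : Eucl n → ℝ} (hρ : Integrable ρ) (h0 : ∀ x, 0 ≤ ρ x)
    (hsol : ∀ᵐ x, SolvesAt (mass ρ) (weight n α μ) β c ρ x) {s : ℝ} (hs : 0 < s)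
    (hs8 : s ≤ 1 / 8) :
    ∃ C : ℝ, 0 ≤ C ∧ ∀ x : Eucl n, x ≠ 0 → ∀ᵐ y, y ∈ ball x (s * ‖x‖) →
      IntegrableOn (fun z => Real.log (‖x‖ / ‖y - z‖)) (ball x (4 * s * ‖x‖)) (mass ρ) ∧
      ρ y ≤ C * (‖x‖ ^ n)⁻¹ * Real.exp
        (β * ∫ z in ball x (4 * s * ‖x‖), Real.log (‖x‖ / ‖y - z‖) ∂(mass ρ)) := by
  have := isFiniteMeasure_mass hρ
  have := nullSingletonClass_mass hn ρ
  set Λ := ∫ x, ρ x with hΛ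
  have hΛ0 : 0 ≤ Λ := integral_nonneg h0
  set V := (volume : Measure (Eucl n)).real (ball 0 1) with hV
  have hVpos : 0 < V := ENNReal.toReal_pos (measure_ball_pos _ _ one_pos).ne' measure_ball_lt_top.ne
  set A : ℝ := 4 ^ |(n : ℝ) * α| with hA
  have hApos : 0 < A := by positivity
  set D := Real.exp (β * (Real.log 3 * (mass ρ).real univ)) with hD
  have hDpos : 0 < D := Real.exp_pos _
  refine ⟨A * (((s / 2) ^ n * V)⁻¹ * Λ) * D, by positivity, fun x hx => ?_⟩
  have hR : 0 < ‖x‖ := norm_pos_iff.2 hx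
  -- The ball `B'` lies in `B(x, 2s|x|)` and is no further from the origin than any point of
  -- `B(x, s|x|)`, so that the Gaussian factor of the weight is at least as large on it.
  set B' : Set (Eucl n) := ball ((1 - 3 * s / 2) • x) (s * ‖x‖ / 2) with hB'
  have hB'1 : ∀ y ∈ B', ‖y‖ ≤ (1 - s) * ‖x‖ ∧ (1 - 2 * s) * ‖x‖ ≤ ‖y‖ ∧
      y ∈ ball x (2 * s * ‖x‖) := by
    intro y hy
    have h1 : ‖y - (1 - 3 * s / 2) • x‖ < s * ‖x‖ / 2 := by
      simpa [B', dist_eq_norm] using hy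
    have h2 : ‖(1 - 3 * s / 2) • x‖ = (1 - 3 * s / 2) * ‖x‖ := by
      rw [norm_smul, Real.norm_of_nonneg (by linarith)]
    have h3 : ‖y‖ ≤ ‖y - (1 - 3 * s / 2) • x‖ + ‖(1 - 3 * s / 2) • x‖ := by
      simpa using norm_add_le (y - (1 - 3 * s / 2) • x) ((1 - 3 * s / 2) • x)
    have h4 : ‖(1 - 3 * s / 2) • x‖ ≤ ‖y‖ + ‖y - (1 - 3 * s / 2) • x‖ := by
      simpa using norm_sub_le y (y - (1 - 3 * s / 2) • x)
    have h5 : ‖y - x‖ ≤ ‖y - (1 - 3 * s / 2) • x‖ + ‖(3 * s / 2) • x‖ := by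
      have e : y - x = (y - (1 - 3 * s / 2) • x) - (3 * s / 2) • x := by module
      rw [e]; exact norm_sub_le _ _
    rw [norm_smul, Real.norm_of_nonneg (by positivity)] at h5
    refine ⟨by nlinarith, by nlinarith, ?_⟩
    rw [mem_ball, dist_eq_norm]; nlinarith
  have hvol : (volume : Measure (Eucl n)).real B' = ((s / 2) ^ n * V) * ‖x‖ ^ n := by
    rw [hB', measureReal_def, Measure.addHaar_ball_of_pos _ _ (by positivity),
      finrank_euclideanSpace, Fintype.card_fin, ENNReal.toReal_mul,
      ENNReal.toReal_ofReal (by positivity), ← measureReal_def, ← hV]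
    ring
  -- a point of `B'` where the equation holds and the density is at most its average
  obtain ⟨y', hy'B, hy'sol, hy'le⟩ : ∃ y' ∈ B', SolvesAt (mass ρ) (weight n α μ) β c ρ y' ∧
      ρ y' ≤ ((s / 2) ^ n * V)⁻¹ * Λ * (‖x‖ ^ n)⁻¹ := by
    have hN : ∀ᵐ y ∂(volume.restrict B'), y ∈ B' ∧ SolvesAt (mass ρ) (weight n α μ) β c ρ y :=
      (ae_restrict_mem measurableSet_ball).and (ae_restrict_of_ae hsol)
    have hne : (volume : Measure (Eucl n)).restrict B' ≠ 0 := by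
      rw [Ne, Measure.restrict_eq_zero]
      exact (measure_ball_pos _ _ (by positivity)).ne'
    have : IsFiniteMeasure ((volume : Measure (Eucl n)).restrict B') :=
      isFiniteMeasure_restrict.2 measure_ball_lt_top.ne
    obtain ⟨y', h1, h2⟩ := exists_notMem_null_le_average hne (hρ.integrableOn (s := B'))
      (ae_iff.1 hN)
    simp only [mem_ofPred_eq, not_not] at h1
    refine ⟨y', h1.1, h1.2, h2.trans ?_⟩
    rw [average_eq, measureReal_restrict_apply_univ, hvol, smul_eq_mul, mul_inv, mul_right_comm]
    gcongr
    exact setIntegral_le_integral hρ (Eventually.of_forall h0)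
  obtain ⟨n1, n2, hyb'⟩ := hB'1 y' hy'B
  have hy'pos : 0 < ‖y'‖ := lt_of_lt_of_le (by nlinarith) n2
  have hy'0 : y' ≠ 0 := norm_pos_iff.1 hy'pos
  filter_upwards [hsol] with y hy hyB
  have hyx : ‖y - x‖ < s * ‖x‖ := by simpa [dist_eq_norm] using hyB
  have m1 : (1 - s) * ‖x‖ ≤ ‖y‖ := by
    have : ‖x‖ ≤ ‖y‖ + ‖y - x‖ := by simpa using norm_sub_le y (y - x)
    nlinarith
  have m2 : ‖y‖ ≤ (1 + s) * ‖x‖ := by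
    have : ‖y‖ ≤ ‖y - x‖ + ‖x‖ := by simpa using norm_add_le (y - x) x
    nlinarith
  obtain ⟨i, hle⟩ := hy.le_mul_exp hβ hs hs8 hx (ball_subset_ball (by nlinarith) hyB) hyb'
    hApos.le (weight_pos α μ hy'0) (h0 y')
    (weight_le_mul hμ hy'0 (n1.trans m1) (by nlinarith)) hy'sol
  refine ⟨i, hle.trans ?_⟩
  gcongr ?_ * _
  calc A * ρ y' * D ≤ A * (((s / 2) ^ n * V)⁻¹ * Λ * (‖x‖ ^ n)⁻¹) * D := by gcongr
    _ = _ := by ring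

/-! ### Boundedness of the dilation invariant potential -/

/-- For a solution, `|x| ∫ ρ(y) / |x - y| dy` is bounded uniformly in `x`. Only the part of the
integral near `x` matters, where Jensen's inequality bounds the density by an average of
`√(|x| / |y - z|)` over `z`, so that `|x| / |x - y|` is integrated against an integrable power. -/
theorem exists_lintegral_div_norm_sub_le (hn : 2 ≤ n) {α μ β c : ℝ} (hμ : 0 ≤ μ) (hβ : 0 < β)
    {ρ : Eucl n → ℝ} (hρ : Integrable ρ) (h0 : ∀ x, 0 ≤ ρ x) (hpos : ∀ᵐ x, 0 < ρ x)
    (hsol : ∀ᵐ x, SolvesAt (mass ρ) (weight n α μ) β c ρ x) :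
    ∃ C : ENNReal, C ≠ ⊤ ∧ ∀ x : Eucl n,
      ∫⁻ y, ENNReal.ofReal (‖x‖ / ‖x - y‖) ∂(mass ρ) ≤ C := by
  have := isFiniteMeasure_mass hρ
  have := nullSingletonClass_mass hn ρ
  obtain ⟨s, hs, hs8, hsmall⟩ := exists_mass_ball_le hn hρ (show 0 < 1 / (2 * β) by positivity)
  obtain ⟨C₁, hC₁, hdens⟩ := exists_density_le hn hμ hβ.le hρ h0 hsol hs hs8
  obtain ⟨C₀, hC₀, hker⟩ := exists_setLIntegral_threeHalves_le hn
  refine ⟨ENNReal.ofReal C₁ * (C₀ + C₀) + ENNReal.ofReal (1 / s) * mass ρ univ, ?_, fun x => ?_⟩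
  · exact ENNReal.add_ne_top.2 ⟨ENNReal.mul_ne_top ENNReal.ofReal_ne_top
      (ENNReal.add_ne_top.2 ⟨hC₀, hC₀⟩), ENNReal.mul_ne_top ENNReal.ofReal_ne_top
      (measure_ne_top _ _)⟩
  rcases eq_or_ne x 0 with rfl | hx
  · simp
  have hR : 0 < ‖x‖ := norm_pos_iff.2 hx
  set R := ‖x‖ with hRdef
  set B₁ := ball x (s * R) with hB₁
  set B := ball x (4 * s * R) with hB
  rw [← lintegral_add_compl _ (measurableSet_ball (x := x) (ε := s * R))]
  refine add_le_add ?_ ?_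
  · -- the part near `x`
    set κ := (mass ρ).restrict B with hκdef
    have hκ0 : κ ≠ 0 := by
      rw [hκdef, Ne, Measure.restrict_eq_zero]
      have h1 : volume B ≠ 0 := (measure_ball_pos _ _ (by positivity)).ne'
      intro h2
      rw [mass, withDensity_apply _ measurableSet_ball,
        lintegral_eq_zero_iff' hρ.aemeasurable.ennreal_ofReal.restrict] at h2
      have h3 : ∀ᵐ y ∂(volume.restrict B), False := by
        filter_upwards [h2, ae_restrict_of_ae hpos] with y h4 h5
        simp only [Pi.zero_apply, ENNReal.ofReal_eq_zero] at h4
        linarith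
      rw [ae_iff] at h3
      simp at h3
      exact h1 h3
    have hκu : κ univ = mass ρ B := by rw [hκdef, Measure.restrict_apply_univ]
    have hκβ : β * κ.real univ ≤ 1 / 2 := by
      rw [measureReal_def, hκu, ← measureReal_def]
      have := hsmall x hx
      calc β * (mass ρ).real B ≤ β * (1 / (2 * β)) := by gcongr
        _ = 1 / 2 := by field_simp
    have hdens' : ∀ᵐ y, y ∈ B₁ → ENNReal.ofReal (ρ y) ≤
        ENNReal.ofReal (C₁ * (R ^ n)⁻¹) *
          ((κ univ)⁻¹ * ∫⁻ z, ENNReal.ofReal (√(R / ‖y - z‖)) ∂κ) := by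
      filter_upwards [hdens x hx] with y hy hyB
      obtain ⟨hi, hle⟩ := hy hyB
      have hyx : ‖y - x‖ < s * R := by simpa [B₁, dist_eq_norm] using hyB
      refine (ENNReal.ofReal_le_ofReal hle).trans ?_
      rw [ENNReal.ofReal_mul (by positivity)]
      gcongr
      have hmem : ∀ᵐ z ∂κ, z ∈ B := ae_restrict_mem measurableSet_ball
      have hnn : 0 ≤ᵐ[κ] fun z => Real.log (R / ‖y - z‖) := by
        filter_upwards [hmem] with z hz
        have hzx : ‖z - x‖ < 4 * s * R := by simpa [B, dist_eq_norm] using hz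
        have h1 : ‖y - z‖ ≤ R := by
          have : ‖y - z‖ ≤ ‖y - x‖ + ‖z - x‖ := by simpa using norm_sub_le (y - x) (z - x)
          nlinarith
        rcases (norm_nonneg (y - z)).eq_or_lt with h2 | h2
        · simp [← h2]
        · exact Real.log_nonneg ((one_le_div h2).2 h1)
      refine (ofReal_exp_mul_integral_le hκ0 hκβ hi hnn).trans ?_
      refine mul_le_mul' le_rfl (lintegral_mono_ae ?_)
      filter_upwards [ae_restrict_of_ae
        (compl_mem_ae_iff.2 (measure_singleton (μ := mass ρ) y))] with z hz
      have h2 : 0 < ‖y - z‖ := by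
        rw [norm_pos_iff, sub_ne_zero]; exact fun h => hz (by simp [h])
      have h3 : 0 < R / ‖y - z‖ := by positivity
      rw [← Real.log_sqrt h3.le, Real.exp_log (Real.sqrt_pos.2 h3)]
    set q : Eucl n → ENNReal := fun y => ENNReal.ofReal (R / ‖x - y‖) with hq
    have hqm : Measurable q := by rw [hq]; fun_prop
    have hkm : Measurable fun p : Eucl n × Eucl n =>
        ENNReal.ofReal (√(R / ‖p.1 - p.2‖)) := by fun_prop
    -- both balls `B(x, R)` and `B(z, R)` contain `B₁`, and the two singularities are separated
    have hinner : ∀ z ∈ B, ∫⁻ y in B₁, q y * ENNReal.ofReal (√(R / ‖y - z‖)) ≤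
        (C₀ + C₀) * ENNReal.ofReal (R ^ n) := by
      intro z hz
      have hzx : ‖z - x‖ < 4 * s * R := by simpa [B, dist_eq_norm] using hz
      calc ∫⁻ y in B₁, q y * ENNReal.ofReal (√(R / ‖y - z‖))
          ≤ ∫⁻ y in B₁, (ENNReal.ofReal (threeHalves (R / ‖y - x‖)) +
              ENNReal.ofReal (threeHalves (R / ‖y - z‖))) := by
            refine lintegral_mono fun y => ?_
            simp only [hq]
            rw [norm_sub_rev x y, ← ENNReal.ofReal_mul (by positivity),
              ← ENNReal.ofReal_add (by unfold threeHalves; positivity)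
                (by unfold threeHalves; positivity)]
            exact ENNReal.ofReal_le_ofReal
              (mul_sqrt_le_threeHalves_add (by positivity) (by positivity))
        _ = (∫⁻ y in B₁, ENNReal.ofReal (threeHalves (R / ‖y - x‖))) +
              ∫⁻ y in B₁, ENNReal.ofReal (threeHalves (R / ‖y - z‖)) := by
            refine lintegral_add_left ?_ _
            exact (measurable_threeHalves.comp (by fun_prop)).ennreal_ofReal
        _ ≤ (∫⁻ y in ball x R, ENNReal.ofReal (threeHalves (R / ‖y - x‖))) +
              ∫⁻ y in ball z R, ENNReal.ofReal (threeHalves (R / ‖y - z‖)) := by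
            refine add_le_add (lintegral_mono_set (ball_subset_ball (by nlinarith)))
              (lintegral_mono_set fun y hy => ?_)
            have hyx : ‖y - x‖ < s * R := by simpa [B₁, dist_eq_norm] using hy
            have : ‖y - z‖ ≤ ‖y - x‖ + ‖z - x‖ := by simpa using norm_sub_le (y - x) (z - x)
            rw [mem_ball, dist_eq_norm]
            nlinarith
        _ ≤ C₀ * ENNReal.ofReal (R ^ n) + C₀ * ENNReal.ofReal (R ^ n) :=
            add_le_add (hker x R hR) (hker z R hR)
        _ = _ := (add_mul _ _ _).symm
    calc ∫⁻ y in B₁, q y ∂(mass ρ)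
        = ∫⁻ y in B₁, ENNReal.ofReal (ρ y) * q y := by
          rw [mass, setLIntegral_withDensity_eq_lintegral_mul₀ hρ.aemeasurable.ennreal_ofReal
            hqm.aemeasurable measurableSet_ball]
          rfl
      _ ≤ ∫⁻ y in B₁, ENNReal.ofReal (C₁ * (R ^ n)⁻¹) * ((κ univ)⁻¹ *
            ∫⁻ z, q y * ENNReal.ofReal (√(R / ‖y - z‖)) ∂κ) := by
          refine lintegral_mono_ae ?_
          filter_upwards [ae_restrict_mem measurableSet_ball, ae_restrict_of_ae hdens']
            with y h1 h2
          rw [lintegral_const_mul _ (by fun_prop)]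
          calc _ ≤ _ := mul_le_mul_left (h2 h1) (q y)
            _ = _ := by ring
      _ = ENNReal.ofReal (C₁ * (R ^ n)⁻¹) * ((κ univ)⁻¹ *
            ∫⁻ y in B₁, ∫⁻ z, q y * ENNReal.ofReal (√(R / ‖y - z‖)) ∂κ) := by
          have hm : Measurable fun y => ∫⁻ z, q y * ENNReal.ofReal (√(R / ‖y - z‖)) ∂κ :=
            Measurable.lintegral_prod_right ((hqm.comp measurable_fst).mul hkm)
          rw [lintegral_const_mul _ (hm.const_mul _), lintegral_const_mul _ hm]
      _ = ENNReal.ofReal (C₁ * (R ^ n)⁻¹) * ((κ univ)⁻¹ *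
            ∫⁻ z, ∫⁻ y in B₁, q y * ENNReal.ofReal (√(R / ‖y - z‖)) ∂volume ∂κ) := by
          rw [lintegral_lintegral_swap]
          exact ((hqm.comp measurable_fst).mul hkm).aemeasurable
      _ ≤ ENNReal.ofReal (C₁ * (R ^ n)⁻¹) * ((κ univ)⁻¹ *
            ∫⁻ _, (C₀ + C₀) * ENNReal.ofReal (R ^ n) ∂κ) := by
          refine mul_le_mul' le_rfl (mul_le_mul' le_rfl (lintegral_mono_ae ?_))
          filter_upwards [ae_restrict_mem measurableSet_ball] with z hz using hinner z hz
      _ = ENNReal.ofReal C₁ * (C₀ + C₀) := by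
          rw [lintegral_const]
          have k0 : κ univ ≠ 0 := by rwa [Ne, Measure.measure_univ_eq_zero]
          have e1 : ENNReal.ofReal (C₁ * (R ^ n)⁻¹) * ENNReal.ofReal (R ^ n) =
              ENNReal.ofReal C₁ := by
            rw [← ENNReal.ofReal_mul (by positivity), mul_assoc,
              inv_mul_cancel₀ (by positivity), mul_one]
          calc _ = (ENNReal.ofReal (C₁ * (R ^ n)⁻¹) * ENNReal.ofReal (R ^ n)) * (C₀ + C₀) *
                ((κ univ)⁻¹ * κ univ) := by ring
            _ = _ := by
              rw [e1, ENNReal.inv_mul_cancel k0 (measure_ne_top _ _), mul_one]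
  · -- the part away from `x`
    calc ∫⁻ y in B₁ᶜ, ENNReal.ofReal (R / ‖x - y‖) ∂(mass ρ)
        ≤ ∫⁻ _ in B₁ᶜ, ENNReal.ofReal (1 / s) ∂(mass ρ) := by
          refine setLIntegral_mono (by fun_prop) fun y hy => ENNReal.ofReal_le_ofReal ?_
          have h1 : s * R ≤ ‖x - y‖ := by
            rw [norm_sub_rev]; simpa [B₁, dist_eq_norm] using hy
          have h2 : 0 < ‖x - y‖ := lt_of_lt_of_le (by positivity) h1
          rw [div_le_div_iff₀ h2 hs]
          linarith
      _ ≤ _ := by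
          rw [setLIntegral_const]
          gcongr
          exact subset_univ _

/-! ### Dilations and the logarithmic energy -/

/-- The logarithmic distance ratio `log (|λx - y| / |x - y|)`, with the junk value `0` where either
distance vanishes. -/
def dilLog (l : ℝ) (p : Eucl n × Eucl n) : ℝ :=
  Real.log (‖l • p.1 - p.2‖ / ‖p.1 - p.2‖)

/-- The dilation invariant kernel `|x| / |x - y|`. -/
def rieszKernel (p : Eucl n × Eucl n) : ℝ := ‖p.1‖ / ‖p.1 - p.2‖

lemma rieszKernel_nonneg (p : Eucl n × Eucl n) : 0 ≤ rieszKernel p := by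
  unfold rieszKernel; positivity

lemma measurable_rieszKernel : Measurable (rieszKernel (n := n)) := by
  unfold rieszKernel; fun_prop

lemma measurable_dilLog (l : ℝ) : Measurable (dilLog (n := n) l) := by
  unfold dilLog; fun_prop

lemma dilLog_le (l : ℝ) (p : Eucl n × Eucl n) : dilLog l p ≤ |l - 1| * rieszKernel p := by
  have hr := mul_nonneg (abs_nonneg (l - 1)) (rieszKernel_nonneg p)
  unfold dilLog
  rcases (norm_nonneg (p.1 - p.2)).eq_or_lt with h | h
  · simpa [← h] using hr
  rcases (norm_nonneg (l • p.1 - p.2)).eq_or_lt with h' | h'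
  · simpa [← h'] using hr
  refine (Real.log_le_sub_one_of_pos (div_pos h' h)).trans ?_
  have e : ‖l • p.1 - p.2‖ ≤ ‖p.1 - p.2‖ + |l - 1| * ‖p.1‖ := by
    have e1 : l • p.1 - p.2 = (p.1 - p.2) + (l - 1) • p.1 := by module
    rw [e1]
    refine (norm_add_le _ _).trans_eq ?_
    rw [norm_smul, Real.norm_eq_abs]
  unfold rieszKernel
  rw [← mul_div_assoc, sub_le_iff_le_add, div_add_one h.ne']
  gcongr
  linarith

/-- The upper bound applied to the inverse dilation; its singularity is at `y = λx`. -/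
lemma neg_dilLog_le {l : ℝ} (hl : 0 < l) (p : Eucl n × Eucl n) :
    -dilLog l p ≤ |l⁻¹ - 1| * rieszKernel (l • p.1, p.2) := by
  refine le_of_eq_of_le ?_ (dilLog_le l⁻¹ (l • p.1, p.2))
  simp only [dilLog]
  rw [inv_smul_smul₀ hl.ne', ← Real.log_inv, inv_div]

lemma integrable_rieszKernel_smul {ν : Measure (Eucl n)} [IsFiniteMeasure ν] {C : ENNReal}
    (hC : C ≠ ⊤) (hν : ∀ x, ∫⁻ y, ENNReal.ofReal (‖x‖ / ‖x - y‖) ∂ν ≤ C) (l : ℝ) :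
    Integrable (fun p : Eucl n × Eucl n => rieszKernel (l • p.1, p.2)) (ν.prod ν) := by
  have hm : Measurable fun p : Eucl n × Eucl n => rieszKernel (l • p.1, p.2) :=
    measurable_rieszKernel.comp (by fun_prop)
  refine (lintegral_ofReal_ne_top_iff_integrable hm.aestronglyMeasurable
    (Eventually.of_forall fun p => rieszKernel_nonneg _)).1 ?_
  rw [lintegral_prod _ hm.ennreal_ofReal.aemeasurable]
  refine ne_top_of_le_ne_top (b := C * ν univ) (ENNReal.mul_ne_top hC (measure_ne_top _ _)) ?_
  rw [← lintegral_const]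
  exact lintegral_mono fun x => hν (l • x)

lemma integrable_rieszKernel {ν : Measure (Eucl n)} [IsFiniteMeasure ν] {C : ENNReal}
    (hC : C ≠ ⊤) (hν : ∀ x, ∫⁻ y, ENNReal.ofReal (‖x‖ / ‖x - y‖) ∂ν ≤ C) :
    Integrable (rieszKernel (n := n)) (ν.prod ν) := by
  simpa using integrable_rieszKernel_smul hC hν 1

lemma integrable_dilLog {ν : Measure (Eucl n)} [IsFiniteMeasure ν] {C : ENNReal}
    (hC : C ≠ ⊤) (hν : ∀ x, ∫⁻ y, ENNReal.ofReal (‖x‖ / ‖x - y‖) ∂ν ≤ C) {l : ℝ} (hl : 0 < l) :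
    Integrable (dilLog (n := n) l) (ν.prod ν) := by
  refine Integrable.mono' (((integrable_rieszKernel hC hν).const_mul |l - 1|).add
    ((integrable_rieszKernel_smul hC hν l).const_mul |l⁻¹ - 1|))
    (measurable_dilLog l).aestronglyMeasurable (Eventually.of_forall fun p => ?_)
  have h1 := dilLog_le l p
  have h2 := neg_dilLog_le hl p
  have h3 := mul_nonneg (abs_nonneg (l - 1)) (rieszKernel_nonneg p)
  have h4 := mul_nonneg (abs_nonneg (l⁻¹ - 1)) (rieszKernel_nonneg (l • p.1, p.2))
  rw [Real.norm_eq_abs, abs_le]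
  simp only [Pi.add_apply]
  constructor <;> linarith

/-- `λ ↦ log (|λx - y| / |x - y|)` cut off from below at `-|λ - 1| |x| / |x - y|`. The cut-off
does not affect the derivative at `λ = 1` but provides an integrable Lipschitz bound. -/
def cutDilLog (l : ℝ) (p : Eucl n × Eucl n) : ℝ := max (dilLog l p) (-(|l - 1| * rieszKernel p))

/-- The derivative of `λ ↦ log (|λx - y| / |x - y|)` at `λ = 1`. -/
def virialKernel (p : Eucl n × Eucl n) : ℝ := inner ℝ p.1 (p.1 - p.2) / ‖p.1 - p.2‖ ^ 2

lemma measurable_virialKernel : Measurable (virialKernel (n := n)) := by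
  unfold virialKernel; fun_prop

lemma abs_virialKernel_le (p : Eucl n × Eucl n) : |virialKernel p| ≤ rieszKernel p := by
  unfold virialKernel rieszKernel
  rcases (norm_nonneg (p.1 - p.2)).eq_or_lt with h | h
  · simp [← h]
  rw [abs_div, abs_of_nonneg (sq_nonneg ‖p.1 - p.2‖), div_le_div_iff₀ (by positivity) h]
  calc _ ≤ (‖p.1‖ * ‖p.1 - p.2‖) * ‖p.1 - p.2‖ := by
        gcongr; exact abs_real_inner_le_norm _ _
    _ = _ := by ring

lemma measurable_cutDilLog (l : ℝ) : Measurable (cutDilLog (n := n) l) :=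
  (measurable_dilLog l).max (measurable_rieszKernel.const_mul _).neg

lemma abs_cutDilLog_le (l : ℝ) (p : Eucl n × Eucl n) :
    |cutDilLog l p| ≤ |l - 1| * rieszKernel p := by
  have h3 := mul_nonneg (abs_nonneg (l - 1)) (rieszKernel_nonneg p)
  exact abs_le.2 ⟨le_max_right _ _, max_le (dilLog_le l p) (by linarith)⟩

lemma dilLog_one (p : Eucl n × Eucl n) : dilLog 1 p = 0 := by
  unfold dilLog
  rw [one_smul]
  rcases eq_or_ne ‖p.1 - p.2‖ 0 with h | h
  · simp [h]
  · simp [div_self h]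

lemma cutDilLog_one (p : Eucl n × Eucl n) : cutDilLog 1 p = 0 := by
  simp [cutDilLog, dilLog_one]

lemma hasDerivAt_dilLog {p : Eucl n × Eucl n} (hp : p.1 ≠ p.2) :
    HasDerivAt (fun l => dilLog l p) (virialKernel p) 1 := by
  have h0 : 0 < ‖p.1 - p.2‖ := norm_pos_iff.2 (sub_ne_zero.2 hp)
  have h1 : HasDerivAt (fun l : ℝ => l • p.1 - p.2) p.1 1 := by
    simpa using ((hasDerivAt_id (1 : ℝ)).smul_const p.1).sub_const p.2
  -- differentiate the square of the norm
  have h2 := (h1.norm_sq.div_const (‖p.1 - p.2‖ ^ 2)).log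
    (by simp only [one_smul]; positivity)
  have h3 := h2.const_mul (1 / 2)
  refine (h3.congr_deriv ?_).congr_of_eventuallyEq (Eventually.of_forall fun l => ?_)
  · simp only [one_smul, virialKernel]
    rw [real_inner_comm]
    field_simp
  · simp only [dilLog]
    rw [← div_pow, Real.log_pow]
    push_cast
    ring

lemma hasDerivAt_cutDilLog {p : Eucl n × Eucl n} (hp : p.1 ≠ p.2) :
    HasDerivAt (fun l => cutDilLog l p) (virialKernel p) 1 := by
  have h := hasDerivAt_dilLog hp
  rw [hasDerivAt_iff_isLittleO] at h ⊢
  refine (Asymptotics.IsBigO.of_bound 1 (Eventually.of_forall fun l => ?_)).trans_isLittleO h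
  simp only [dilLog_one, cutDilLog_one, sub_zero, smul_eq_mul, one_mul, Real.norm_eq_abs]
  have h1 : -(|l - 1| * rieszKernel p) ≤ (l - 1) * virialKernel p := by
    have h2 := neg_abs_le ((l - 1) * virialKernel p)
    rw [abs_mul] at h2
    have h3 := mul_le_mul_of_nonneg_left (abs_virialKernel_le p) (abs_nonneg (l - 1))
    linarith
  unfold cutDilLog
  rcases le_total (-(|l - 1| * rieszKernel p)) (dilLog l p) with h4 | h4
  · rw [max_eq_left h4]
  · rw [max_eq_right h4,
      abs_of_nonpos (a := -(|l - 1| * rieszKernel p) - (l - 1) * virialKernel p) (by linarith),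
      abs_of_nonpos (a := dilLog l p - (l - 1) * virialKernel p) (by linarith)]
    linarith

lemma ae_prod_ne (ν : Measure (Eucl n)) [IsFiniteMeasure ν] [NullSingletonClass ν] :
    ∀ᵐ p : Eucl n × Eucl n ∂(ν.prod ν), p.1 ≠ p.2 := by
  rw [Measure.ae_prod_iff_ae_ae]
  · refine Eventually.of_forall fun x => ?_
    filter_upwards [compl_mem_ae_iff.2 (measure_singleton (μ := ν) x)] with y hy h
    exact hy (by simp [show x = y from h])
  · exact (measurableSet_eq_fun measurable_fst measurable_snd).compl

/-- Symmetrization: `x·(x - y) + y·(y - x) = |x - y|²`. -/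
lemma integral_virialKernel {ν : Measure (Eucl n)} [IsFiniteMeasure ν] [NullSingletonClass ν]
    (hint : Integrable (virialKernel (n := n)) (ν.prod ν)) :
    ∫ p, virialKernel p ∂(ν.prod ν) = ν.real univ ^ 2 / 2 := by
  have h1 : ∫ p : Eucl n × Eucl n, virialKernel p.swap ∂(ν.prod ν) =
      ∫ p, virialKernel p ∂(ν.prod ν) := integral_prod_swap virialKernel
  have h2 : ∫ p : Eucl n × Eucl n, (virialKernel p + virialKernel p.swap) ∂(ν.prod ν) =
      ∫ _, (1 : ℝ) ∂(ν.prod ν) := by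
    refine integral_congr_ae ?_
    filter_upwards [ae_prod_ne ν] with p hp
    have h0 : 0 < ‖p.1 - p.2‖ := norm_pos_iff.2 (sub_ne_zero.2 hp)
    simp only [virialKernel, Prod.fst_swap, Prod.snd_swap]
    rw [norm_sub_rev p.2 p.1, ← add_div, div_eq_one_iff_eq (by positivity),
      ← real_inner_self_eq_norm_sq, ← neg_sub p.1 p.2, inner_neg_right, ← sub_eq_add_neg,
      ← inner_sub_left]
  have h4 : ∫ p : Eucl n × Eucl n, (virialKernel p + virialKernel p.swap) ∂(ν.prod ν) =
      ∫ p, virialKernel p ∂(ν.prod ν) + ∫ p : Eucl n × Eucl n, virialKernel p.swap ∂(ν.prod ν) :=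
    integral_add hint hint.swap
  have h3 : ∫ _ : Eucl n × Eucl n, (1 : ℝ) ∂(ν.prod ν) = ν.real univ ^ 2 := by
    rw [integral_const, smul_eq_mul, mul_one, ← univ_prod_univ, measureReal_prod_prod, sq]
  linarith

lemma hasDerivAt_integral_cutDilLog {ν : Measure (Eucl n)} [IsFiniteMeasure ν]
    [NullSingletonClass ν] (hint : Integrable (rieszKernel (n := n)) (ν.prod ν)) :
    HasDerivAt (fun l => ∫ p, cutDilLog l p ∂(ν.prod ν)) (ν.real univ ^ 2 / 2) 1 := by
  have hv : Integrable (virialKernel (n := n)) (ν.prod ν) :=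
    hint.mono' measurable_virialKernel.aestronglyMeasurable
      (Eventually.of_forall abs_virialKernel_le)
  obtain ⟨i, h⟩ := hasFDerivAt_integral_of_dominated_loc_of_lip' (μ := ν.prod ν) (𝕜 := ℝ)
    (F := cutDilLog (n := n)) (x₀ := 1) (s := univ) (bound := rieszKernel)
    (F' := fun p => ContinuousLinearMap.toSpanSingleton ℝ (virialKernel p)) univ_mem
    (fun l _ => (measurable_cutDilLog l).aestronglyMeasurable)
    ((integrable_zero _ _ _).congr (Eventually.of_forall fun p => (cutDilLog_one p).symm))
    ((ContinuousLinearMap.toSpanSingletonCLE (𝕜 := ℝ)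
      (E := ℝ)).continuous.comp_aestronglyMeasurable hv.aestronglyMeasurable)
    (Eventually.of_forall fun p l _ => by
      rw [cutDilLog_one, sub_zero, Real.norm_eq_abs, Real.norm_eq_abs, mul_comm]
      exact abs_cutDilLog_le l p)
    hint
    ((ae_prod_ne ν).mono fun p hp => (hasDerivAt_cutDilLog hp).hasFDerivAt)
  have h' := h.hasDerivAt
  rw [ContinuousLinearMap.integral_apply i] at h'
  simpa [integral_virialKernel hv] using h'

/-! ### The dilation inequality and the virial identity -/

section Dilation

variable {α μ β c : ℝ} {ρ : Eucl n → ℝ}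

/-- The inequality `1 + t ≤ eᵗ` for the logarithm `t` of the quotient of `λⁿρ(λx)` by `ρ(x)`. -/
lemma ae_mul_log_dilation_le (hn : 2 ≤ n) (h0 : ∀ x, 0 ≤ ρ x)
    (hsol : ∀ᵐ x, SolvesAt (mass ρ) (weight n α μ) β c ρ x) {l : ℝ} (hl : 0 < l) :
    ∀ᵐ x, ρ x * (n * (1 + α) * Real.log l - (l ^ 2 - 1) * (μ * ‖x‖ ^ 2) -
      β * ∫ y, dilLog l (x, y) ∂(mass ρ)) ≤ l ^ n * ρ (l • x) - ρ x := by
  have : Nonempty (Fin n) := ⟨⟨0, by omega⟩⟩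
  have := nullSingletonClass_mass hn ρ
  have hq : Measure.QuasiMeasurePreserving (fun x : Eucl n => l • x) volume volume := by
    refine ⟨by fun_prop, ?_⟩
    rw [Measure.map_addHaar_smul _ hl.ne']
    exact Measure.smul_absolutelyContinuous
  filter_upwards [hsol, hq.ae hsol,
    compl_mem_ae_iff.2 (measure_singleton (μ := (volume : Measure (Eucl n))) 0)] with x h1 h2 hx
  have hR : 0 < ‖x‖ := norm_pos_iff.2 hx
  obtain ⟨-, h⟩ := h2.ratio h1
  have hK : l ^ n * weight n α μ (l • x) = weight n α μ x *
      Real.exp (n * (1 + α) * Real.log l - (l ^ 2 - 1) * (μ * ‖x‖ ^ 2)) := by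
    have e1 : l ^ n = Real.exp (n * Real.log l) := by
      rw [← Real.log_pow, Real.exp_log (by positivity)]
    unfold weight
    rw [norm_smul, Real.norm_of_nonneg hl.le, Real.mul_rpow hl.le hR.le, e1,
      Real.rpow_def_of_pos hl]
    calc _ = ‖x‖ ^ ((n : ℝ) * α) * (Real.exp (n * Real.log l) * Real.exp (Real.log l * (n * α)) *
          Real.exp (-μ * (l * ‖x‖) ^ 2)) := by ring
      _ = _ := by
        rw [← Real.exp_add, ← Real.exp_add, mul_assoc, ← Real.exp_add]
        congr 2
        ring
  have hlog : ∫ y, Real.log (‖x - y‖ / ‖l • x - y‖) ∂(mass ρ) =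
      -∫ y, dilLog l (x, y) ∂(mass ρ) := by
    rw [← integral_neg]
    congr 1 with y
    rw [dilLog, ← Real.log_inv, inv_div]
  rw [hlog] at h
  set t := n * (1 + α) * Real.log l - (l ^ 2 - 1) * (μ * ‖x‖ ^ 2) -
      β * ∫ y, dilLog l (x, y) ∂(mass ρ) with ht
  have hmain : l ^ n * ρ (l • x) = ρ x * Real.exp t := by
    have hKx := weight_pos (n := n) α μ hx
    refine mul_right_cancel₀ hKx.ne' ?_
    calc _ = l ^ n * (ρ (l • x) * weight n α μ x) := by ring
      _ = ρ x * (l ^ n * weight n α μ (l • x)) *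
          Real.exp (β * -∫ y, dilLog l (x, y) ∂(mass ρ)) := by rw [h]; ring
      _ = ρ x * weight n α μ x * (Real.exp (n * (1 + α) * Real.log l -
          (l ^ 2 - 1) * (μ * ‖x‖ ^ 2)) *
          Real.exp (β * -∫ y, dilLog l (x, y) ∂(mass ρ))) := by rw [hK]; ring
      _ = _ := by
        rw [← Real.exp_add, ht]
        ring_nf
  rw [hmain]
  nlinarith [mul_le_mul_of_nonneg_left (Real.add_one_le_exp t) (h0 x)]

/-- A second moment need not be assumed: for `λ < 1` it enters the dilation inequality with the
favourable sign. -/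
lemma integrable_mul_norm_sq (hn : 2 ≤ n) (hμ : 0 ≤ μ) (hρ : Integrable ρ) (h0 : ∀ x, 0 ≤ ρ x)
    (hsol : ∀ᵐ x, SolvesAt (mass ρ) (weight n α μ) β c ρ x) {C : ENNReal} (hC : C ≠ ⊤)
    (hν : ∀ x : Eucl n, ∫⁻ y, ENNReal.ofReal (‖x‖ / ‖x - y‖) ∂(mass ρ) ≤ C) :
    Integrable (fun x => μ * ‖x‖ ^ 2) (mass ρ) := by
  have := isFiniteMeasure_mass hρ
  have hg : Integrable (fun x => ρ x * ∫ y, dilLog (1 / 2) (x, y) ∂(mass ρ)) :=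
    (integrable_mass_iff hρ h0).1
      (integrable_dilLog hC hν (l := 1 / 2) (by norm_num)).integral_prod_left
  have hd : Integrable fun x => ρ ((1 / 2 : ℝ) • x) := hρ.comp_smul (by norm_num)
  rw [integrable_mass_iff hρ h0]
  refine Integrable.mono' ((((hd.const_mul ((1 / 2) ^ n)).sub hρ).sub
    (hρ.mul_const (n * (1 + α) * Real.log (1 / 2)))).add (hg.const_mul β) |>.const_mul (4 / 3))
    (hρ.aestronglyMeasurable.mul (Measurable.aestronglyMeasurable (by fun_prop))) ?_
  filter_upwards [ae_mul_log_dilation_le hn h0 hsol (l := 1 / 2) (by norm_num)] with x hx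
  have h1 : 0 ≤ ρ x * (μ * ‖x‖ ^ 2) := mul_nonneg (h0 x) (by positivity)
  rw [Real.norm_of_nonneg h1]
  simp only [Pi.add_apply, Pi.sub_apply]
  linarith

/-- Gibbs' inequality: the relative entropy of the solution with respect to its dilation is
nonnegative, both having the same mass. -/
lemma dilation_inequality (hn : 2 ≤ n) (hμ : 0 ≤ μ) (hρ : Integrable ρ) (h0 : ∀ x, 0 ≤ ρ x)
    (hsol : ∀ᵐ x, SolvesAt (mass ρ) (weight n α μ) β c ρ x) {C : ENNReal} (hC : C ≠ ⊤)
    (hν : ∀ x : Eucl n, ∫⁻ y, ENNReal.ofReal (‖x‖ / ‖x - y‖) ∂(mass ρ) ≤ C) {l : ℝ}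
    (hl : 0 < l) :
    n * (1 + α) * Real.log l * (mass ρ).real univ -
      (l ^ 2 - 1) * ∫ x, μ * ‖x‖ ^ 2 ∂(mass ρ) -
      β * ∫ p, dilLog l p ∂((mass ρ).prod (mass ρ)) ≤ 0 := by
  have := isFiniteMeasure_mass hρ
  have hi := integrable_dilLog hC hν hl
  have hM := integrable_mul_norm_sq hn hμ hρ h0 hsol hC hν
  have hg := hi.integral_prod_left
  have hd : Integrable fun x => ρ (l • x) := hρ.comp_smul hl.ne'
  have ht₀ : Integrable (fun x => n * (1 + α) * Real.log l - (l ^ 2 - 1) * (μ * ‖x‖ ^ 2))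
    (mass ρ) := (integrable_const _).sub (hM.const_mul _)
  have ht : Integrable (fun x => n * (1 + α) * Real.log l - (l ^ 2 - 1) * (μ * ‖x‖ ^ 2) -
      β * ∫ y, dilLog l (x, y) ∂(mass ρ)) (mass ρ) := ht₀.sub (hg.const_mul _)
  have key := integral_mono_ae ((integrable_mass_iff hρ h0).1 ht)
    ((hd.const_mul (l ^ n)).sub hρ) (ae_mul_log_dilation_le hn h0 hsol hl)
  rw [← integral_mass hρ h0, integral_sub' (hd.const_mul _) hρ, integral_const_mul,
    Measure.integral_comp_smul, finrank_euclideanSpace, Fintype.card_fin,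
    abs_of_pos (by positivity), smul_eq_mul, ← mul_assoc, mul_inv_cancel₀ (by positivity), one_mul,
    sub_self, integral_sub ht₀ (hg.const_mul _),
    integral_sub (integrable_const _) (hM.const_mul _), integral_const, integral_const_mul (l ^ 2 - 1),
    integral_const_mul β, smul_eq_mul, mul_comm ((mass ρ).real univ)] at key
  rwa [integral_prod _ hi]

/-- The virial (Pohozaev) identity: the dilation inequality is an equality at `λ = 1`, so the
derivatives there agree. -/
theorem virial_identity (hn : 2 ≤ n) (hμ : 0 ≤ μ) (hβ : 0 < β) (hρ : Integrable ρ)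
    (h0 : ∀ x, 0 ≤ ρ x) (hpos : ∀ᵐ x, 0 < ρ x)
    (hsol : ∀ᵐ x, SolvesAt (mass ρ) (weight n α μ) β c ρ x) :
    Integrable (fun x => μ * ‖x‖ ^ 2) (mass ρ) ∧
    n * (1 + α) * (mass ρ).real univ =
      2 * ∫ x, μ * ‖x‖ ^ 2 ∂(mass ρ) + β * ((mass ρ).real univ ^ 2 / 2) := by
  have := isFiniteMeasure_mass hρ
  have := nullSingletonClass_mass hn ρ
  obtain ⟨C, hC, hν⟩ := exists_lintegral_div_norm_sub_le hn hμ hβ hρ h0 hpos hsol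
  refine ⟨integrable_mul_norm_sq hn hμ hρ h0 hsol hC hν, ?_⟩
  have hr := integrable_rieszKernel hC hν
  set Λ := (mass ρ).real univ
  set M := ∫ x, μ * ‖x‖ ^ 2 ∂(mass ρ)
  set φ : ℝ → ℝ := fun l => n * (1 + α) * Real.log l * Λ - (l ^ 2 - 1) * M -
    β * ∫ p, cutDilLog l p ∂((mass ρ).prod (mass ρ)) with hφ
  have hφ1 : φ 1 = 0 := by simp [hφ, cutDilLog_one]
  have hmax : IsLocalMax φ 1 := by
    filter_upwards [lt_mem_nhds (show (0 : ℝ) < 1 by norm_num)] with l hl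
    rw [hφ1]
    refine le_trans ?_ (dilation_inequality hn hμ hρ h0 hsol hC hν hl)
    have hcut : Integrable (cutDilLog l) ((mass ρ).prod (mass ρ)) :=
      (hr.const_mul |l - 1|).mono' (measurable_cutDilLog l).aestronglyMeasurable
        (Eventually.of_forall (abs_cutDilLog_le l))
    have := integral_mono (integrable_dilLog hC hν hl) hcut fun p => le_max_left _ _
    simp only [hφ]
    gcongr
  have hd : HasDerivAt φ (n * (1 + α) * 1⁻¹ * Λ - (2 * 1) * M - β * (Λ ^ 2 / 2)) 1 := by
    refine HasDerivAt.sub (HasDerivAt.sub ?_ ?_) ?_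
    · exact ((Real.hasDerivAt_log one_ne_zero).const_mul _).mul_const _
    · simpa using ((hasDerivAt_pow 2 (1 : ℝ)).sub_const 1).mul_const M
    · exact (hasDerivAt_integral_cutDilLog hr).const_mul β
  have := hmax.hasDerivAt_eq_zero hd
  simp only [inv_one, mul_one] at this
  linarith

end Dilation

/-! ### The mass of a solution -/

lemma sphereArea_pos (n : ℕ) : 0 < sphereArea n := by
  unfold sphereArea
  rw [Measure.toSphere_real_apply_univ, finrank_euclideanSpace, Fintype.card_fin]
  have : 0 < (volume : Measure (Eucl (n + 1))).real (ball 0 1) :=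
    ENNReal.toReal_pos (measure_ball_pos _ _ one_pos).ne' measure_ball_lt_top.ne
  positivity

lemma gammaConst_pos (n : ℕ) : 0 < gammaConst n := by
  have := sphereArea_pos n
  unfold gammaConst
  positivity

lemma Lambda1_eq (n : ℕ) : Lambda1 n = 2 * gammaConst n := by
  unfold Lambda1 gammaConst; ring

lemma density_pos (α μ : ℝ) (η : Eucl n → ℝ) {x : Eucl n} (hx : x ≠ 0) :
    0 < density n (weight n α μ) η x :=
  mul_pos (weight_pos α μ hx) (Real.exp_pos _)

lemma density_nonneg (α μ : ℝ) (η : Eucl n → ℝ) (x : Eucl n) :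
    0 ≤ density n (weight n α μ) η x :=
  mul_nonneg (weight_nonneg α μ x) (Real.exp_pos _).le

lemma SolvesIntegralEq.ae_solvesAt {α μ c : ℝ} {η : Eucl n → ℝ}
    (hη : SolvesIntegralEq n (weight n α μ) c η)
    (hfin : Integrable (density n (weight n α μ) η)) :
    ∀ᵐ x, SolvesAt (mass (density n (weight n α μ) η)) (weight n α μ) (n / gammaConst n) (n * c)
      (density n (weight n α μ) η) x := by
  have h0 := density_nonneg α μ η
  filter_upwards [hη] with x hx
  simp_rw [mul_comm (Real.log _)] at hx
  refine ⟨(integrable_mass_iff hfin h0).2 hx.1, ?_⟩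
  rw [integral_mass hfin h0]
  conv_lhs => rw [density, hx.2]
  simp only [logKernel]
  ring_nf

end LogIntegralEq

end

theorem propositionA2 (n : ℕ) (hn : 2 ≤ n) (α : ℝ) (hα : -1 < α) (μ : ℝ) (hμ : 0 ≤ μ)
    (c : ℝ) (η : EuclideanSpace ℝ (Fin n) → ℝ)
    (hη : LogIntegralEq.SolvesIntegralEq n (LogIntegralEq.weight n α μ) c η)
    (hfin : MeasureTheory.Integrable
      (LogIntegralEq.density n (LogIntegralEq.weight n α μ) η))
    (Λ : ℝ)
    (hΛ : Λ = ∫ x : EuclideanSpace ℝ (Fin n),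
      LogIntegralEq.density n (LogIntegralEq.weight n α μ) η x) :
    Λ ≤ LogIntegralEq.Lambda1 n * (1 + α) ∧
      (Λ = LogIntegralEq.Lambda1 n * (1 + α) ↔ μ = 0) := by
  open LogIntegralEq in
  have : Nonempty (Fin n) := ⟨⟨0, by omega⟩⟩
  have hn0 : (0 : ℝ) < n := by positivity
  have hγ := gammaConst_pos n
  set ρ := density n (weight n α μ) η with hρdef
  have h0 : ∀ x, 0 ≤ ρ x := density_nonneg α μ η
  have hne : ∀ᵐ x : Eucl n, x ≠ 0 := compl_mem_ae_iff.2 (measure_singleton 0)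
  have hpos : ∀ᵐ x, 0 < ρ x := hne.mono fun x hx => density_pos α μ η hx
  have pos_of_ae : ∀ f : Eucl n → ℝ, Integrable f → (∀ᵐ x, 0 < f x) → 0 < ∫ x, f x := by
    intro f hf hf0
    rw [integral_pos_iff_support_of_nonneg_ae (hf0.mono fun x hx => hx.le) hf]
    have : Function.support f =ᵐ[volume] Set.univ :=
      Filter.eventuallyEq_univ.2 (hf0.mono fun x hx => hx.ne')
    rw [measure_congr this]
    simp
  have hΛpos : 0 < Λ := hΛ ▸ pos_of_ae ρ hfin hpos
  obtain ⟨hM, hvir⟩ := virial_identity hn hμ (div_pos hn0 hγ) hfin h0 hpos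
    (hη.ae_solvesAt hfin)
  rw [mass_real_univ hfin h0, ← hΛ] at hvir
  set M := ∫ x, μ * ‖x‖ ^ 2 ∂(mass ρ) with hMdef
  -- the virial identity in the form `Λ₁ (1 + α) - Λ = (2 Λ₁ / (n Λ)) M`
  have hgap : n * Λ * (Lambda1 n * (1 + α) - Λ) = 4 * gammaConst n * M := by
    rw [Lambda1_eq]
    field_simp at hvir
    linarith
  have hMnn : 0 ≤ M := integral_nonneg fun x => by positivity
  have hnΛ : 0 < n * Λ := mul_pos hn0 hΛpos
  refine ⟨?_, ?_, ?_⟩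
  · have : 0 ≤ n * Λ * (Lambda1 n * (1 + α) - Λ) := by rw [hgap]; positivity
    linarith [nonneg_of_mul_nonneg_right this hnΛ]
  · intro heq
    by_contra hμ0
    have hμpos : 0 < μ := lt_of_le_of_ne hμ (Ne.symm hμ0)
    have hMpos : 0 < M := by
      rw [hMdef, integral_mass hfin h0]
      refine pos_of_ae _ ((integrable_mass_iff hfin h0).1 hM) ?_
      filter_upwards [hpos, hne] with x h1 h2
      have : 0 < ‖x‖ := norm_pos_iff.2 h2
      positivity
    rw [heq, sub_self, mul_zero] at hgap
    nlinarith [mul_pos hγ hMpos]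
  · intro h
    have hM0 : M = 0 := by simp [hMdef, h]
    rw [hM0, mul_zero] at hgap
    rcases mul_eq_zero.1 hgap with h1 | h1
    · exact absurd h1 hnΛ.ne'
    · linarith
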